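/- Let $f=(f_1,\dots,f_n)$ be polynomials with complex coefficients in $n$ variables $x=(x_1,\dots,x_n)$ and $m$ parameters $\lambda=(\lambda_1,\dots,\lambda_m)$, and let $A(x,\lambda)=\bigl(\partial f_i/\partial x_j\bigr)_{i,j}$. A point $(x,\lambda)$ is called singular if $A(x,\lambda)$ has rank less than $n$, and regular otherwise. For $\lambda^{(0)},\lambda^{(1)}\in\mathbb C^m$ consider the sweeping homotopy $$h(x,\lambda,t)=\bigl(f(x,\lambda),\ (1-t)(\lambda-\lambda^{(0)})+t(\lambda-\lambda^{(1)})\bigr)=0 .$$ Let $t_1<t_3$ be real numbers (for instance with $[t_1,t_3]\subseteq[0,1]$) and let $t\mapsto(x(t),\lambda(t))\in\mathbb C^n\times\mathbb C^m$ be a continuous solution path of the homotopy on $[t_1,t_3]$. Suppose the path has an isolated (finite) singularity at $t_*\in[t_1,t_3]$: the point $(x(t_*),\lambda(t_*))$ is singular, while $(x(t),\lambda(t))$ is regular for all $t\neq t_*$ in $[t_1,t_3]$ sufficiently close to $t_*$. Then there are rational numbers $p,q>0$ and nonzero complex numbers $c,d$ such that, as $t\to t_*$ in $[t_1,t_3]$,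 $$\det A(x(t),\lambda(t))\sim c\,(t-t_*)^p\quad (t>t_*),\qquad \det A(x(t),\lambda(t))\sim d\,(t_*-t)^q\quad (t<t_*),$$ where $\sim$ means that the quotient tends to $1$ (a condition on one side is void if $t_*$ is the corresponding endpoint). Moreover, if the two parts of the path belong to one branch, in the sense that for some integer $k$ the part with $t<t_*$ is obtained from the part with $t>t_*$ by continuing the solution, through regular solutions of the homotopy for complex $t$ close to $t_*$ (that is, continuously in $w=\log(t-t_*)$ on a half plane $\operatorname{Re} w<R$), along a turn of angle $(2k+1)\pi$ around $t_*$, then $q=p$ and $d=c\,e^{(2k+1)\pi i p}$. So in this case $\det A(x(t),\lambda(t))\sim c\,(t-t_*)^p$ on both sides of $t_*$, with $(t-t_*)^p$ continued along the same turn. -/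

import Mathlib

namespace Sweep

open Filter Topology

/-- A square polynomial system: `n` polynomials in `n` variables (`Sum.inl`) and
`m` parameters (`Sum.inr`), with complex coefficients. -/
abbrev PolySystem (n m : ℕ) : Type := Fin n → MvPolynomial (Fin n ⊕ Fin m) ℂ

/-- The value `f (x, lam)`. -/
noncomputable def value {n m : ℕ} (f : PolySystem n m) (x : Fin n → ℂ) (lam : Fin m → ℂ) :
    Fin n → ℂ :=
  fun i => MvPolynomial.eval (Sum.elim x lam) (f i)

/-- The Jacobian matrix `A (x, lam)` with entries `∂ f i / ∂ x j`. -/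
noncomputable def jacobian {n m : ℕ} (f : PolySystem n m) (x : Fin n → ℂ) (lam : Fin m → ℂ) :
    Matrix (Fin n) (Fin n) ℂ :=
  Matrix.of fun i j =>
    MvPolynomial.eval (Sum.elim x lam) (MvPolynomial.pderiv (Sum.inl j) (f i))

/-- The sweeping homotopy
`h (x, lam, t) = (f (x, lam), (1 - t) (lam - lam₀) + t (lam - lam₁))`. -/
noncomputable def homotopy {n m : ℕ} (f : PolySystem n m) (lam₀ lam₁ : Fin m → ℂ)
    (x : Fin n → ℂ) (lam : Fin m → ℂ) (t : ℂ) : (Fin n → ℂ) × (Fin m → ℂ) :=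
  (value f x lam, (1 - t) • (lam - lam₀) + t • (lam - lam₁))

/-- The point `(x, lam)` is singular: the Jacobian matrix has rank less than `n`. -/
def IsSingularPoint {n m : ℕ} (f : PolySystem n m) (x : Fin n → ℂ) (lam : Fin m → ℂ) : Prop :=
  (jacobian f x lam).rank < n

/-- `t ↦ (x t, lam t)` is a (continuous, hence finite) solution path of the sweeping homotopy
over the set `I` of real values of `t`. -/
structure IsSolutionPath {n m : ℕ} (f : PolySystem n m) (lam₀ lam₁ : Fin m → ℂ)
    (I : Set ℝ) (x : ℝ → Fin n → ℂ) (lam : ℝ → Fin m → ℂ) : Prop where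
  continuousOn_x : ContinuousOn x I
  continuousOn_lam : ContinuousOn lam I
  solves : ∀ t ∈ I, homotopy f lam₀ lam₁ (x t) (lam t) (t : ℂ) = 0

/-- The path has an isolated singularity at `ts`: its point at `ts` is singular, and its
points at all other `t ∈ I` close to `ts` are regular. -/
structure HasIsolatedSingularityAt {n m : ℕ} (f : PolySystem n m)
    (I : Set ℝ) (x : ℝ → Fin n → ℂ) (lam : ℝ → Fin m → ℂ) (ts : ℝ) : Prop where
  mem : ts ∈ I
  singular : IsSingularPoint f (x ts) (lam ts)
  isolated : ∀ᶠ t in 𝓝[I \ {ts}] ts, ¬ IsSingularPoint f (x t) (lam t)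

/-- The part of the path before `ts` is the analytic continuation of the part after `ts` when
the complex variable `t` turns around `ts` by the angle `(2 k + 1) π`.  The continuation is
written in the coordinate `w = log (t - ts)`, with `w` in a left half plane; it goes through
regular solutions of the homotopy, near which solutions are unique, so that continuity of
`X` and `L` suffices. -/
def IsSameBranch {n m : ℕ} (f : PolySystem n m) (lam₀ lam₁ : Fin m → ℂ)
    (x : ℝ → Fin n → ℂ) (lam : ℝ → Fin m → ℂ) (ts : ℝ) (k : ℤ) : Prop :=
  ∃ (R : ℝ) (X : ℂ → Fin n → ℂ) (L : ℂ → Fin m → ℂ),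
    ContinuousOn X {w : ℂ | w.re < R} ∧
    ContinuousOn L {w : ℂ | w.re < R} ∧
    (∀ w : ℂ, w.re < R →
      homotopy f lam₀ lam₁ (X w) (L w) ((ts : ℂ) + Complex.exp w) = 0 ∧
      ¬ IsSingularPoint f (X w) (L w)) ∧
    (∀ u : ℝ, u < R →
      X (u : ℂ) = x (ts + Real.exp u) ∧ L (u : ℂ) = lam (ts + Real.exp u)) ∧
    (∀ u : ℝ, u < R →
      X ((u : ℂ) + (2 * (k : ℂ) + 1) * (Real.pi : ℂ) * Complex.I) = x (ts - Real.exp u) ∧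
      L ((u : ℂ) + (2 * (k : ℂ) + 1) * (Real.pi : ℂ) * Complex.I) = lam (ts - Real.exp u))

end Sweep

namespace Sweep

open Filter Topology

/-! Write t - ts = ±s with s = e^w. After the parameters are eliminated, the regular zeros of f form
a scheme of finite type over ℂ[s]. It is unramified by the Jacobian criterion, hence finite over the
fraction field, so the Jacobian determinant D is algebraic over ℂ[s] (`exists_relation_of_system`):
a single nonzero P satisfies P(e^w, D) = 0 at all regular solutions.

The leading term then comes from Newton's polygon, without Puiseux series (`exists_leading_term`).
In a vanishing sum two terms have comparable size, so log ‖D‖ stays within bounded distance of p ·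
re w for one of finitely many rational p; connectedness fixes p. Then D e^(-pw) is bounded above and
below and nearly a root of an edge polynomial; connectedness again fixes the root c to which it
converges.

The domain of w need only be convex. A half-line gives the one-sided asymptotics. A half plane gives
the same p and c along every horizontal line, and comparing im w = 0 with im w = (2k+1)π gives the
factor of the turn. -/

/-! ### Limits as re w → -∞ on a convex set -/

/-- The filter of points of `W` whose real part tends to `-∞`. -/
def reAtBot (W : Set ℂ) : Filter ℂ := comap Complex.re atBot ⊓ 𝓟 W

theorem hasBasis_reAtBot (W : Set ℂ) :
    (reAtBot W).HasBasis (fun _ : ℝ => True) (fun r => W ∩ {w | w.re < r}) := by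
  have h := ((atBot_basis_Iio (α := ℝ)).comap Complex.re).inf_principal W
  refine h.to_hasBasis (fun r _ => ⟨r, trivial, ?_⟩) (fun r _ => ⟨r, trivial, ?_⟩)
  · rintro w ⟨h1, h2⟩; exact ⟨h2, h1⟩
  · rintro w ⟨h1, h2⟩; exact ⟨h2, h1⟩

theorem tendsto_re_reAtBot (W : Set ℂ) : Tendsto Complex.re (reAtBot W) atBot :=
  tendsto_comap.mono_left inf_le_left

theorem eventually_mem_reAtBot (W : Set ℂ) : ∀ᶠ w in reAtBot W, w ∈ W :=
  mem_inf_of_right (mem_principal_self W)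

/-- A continuous function on a convex set that accumulates, as the real part tends to `-∞`,
only at points of a finite set converges to one of them. -/
theorem exists_tendsto_of_near_finset {E : Type*} [MetricSpace E] {W : Set ℂ}
    (hW : Convex ℝ W) [(reAtBot W).NeBot] {g : ℂ → E} {R : ℝ}
    (hg : ContinuousOn g (W ∩ {w | w.re < R})) (Z : Finset E)
    (hZ : ∀ ε > 0, ∀ᶠ w in reAtBot W, ∃ z ∈ Z, dist (g w) z < ε) :
    ∃ z ∈ Z, Tendsto g (reAtBot W) (𝓝 z) := by
  -- Half the least distance between distinct points of `Z`, so that the δ-balls around them are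
  -- disjoint.
  obtain ⟨δ, hδ, hsep⟩ : ∃ δ > 0, ∀ z ∈ Z, ∀ z' ∈ Z, dist z z' < 2 * δ → z = z' := by
    obtain ⟨δ, hδ, h⟩ : ∃ δ > 0, ∀ q ∈ Z.offDiag, 2 * δ ≤ dist q.1 q.2 := by
      by_cases hne : Z.offDiag.Nonempty
      · obtain ⟨q, hq, hmin⟩ := Z.offDiag.exists_min_image (fun q => dist q.1 q.2) hne
        refine ⟨dist q.1 q.2 / 2, ?_, fun q' hq' => ?_⟩
        · have := dist_pos.2 (Finset.mem_offDiag.1 hq).2.2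
          positivity
        · have := hmin q' hq'
          linarith
      · refine ⟨1, one_pos, fun q hq => (hne ⟨q, hq⟩).elim⟩
    refine ⟨δ, hδ, fun z hz z' hz' hd => ?_⟩
    by_contra hne
    exact absurd (h (z, z') (Finset.mem_offDiag.2 ⟨hz, hz', hne⟩)) (not_le.2 hd)
  obtain ⟨r₀, -, hr₀⟩ := (hasBasis_reAtBot W).eventually_iff.1 (hZ δ hδ)
  set V := W ∩ {w : ℂ | w.re < min r₀ R} with hV
  have hVr₀ : V ⊆ W ∩ {w | w.re < r₀} :=
    fun w hw => ⟨hw.1, (lt_min_iff.1 (show w.re < min r₀ R from hw.2)).1⟩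
  have hVR : V ⊆ W ∩ {w | w.re < R} :=
    fun w hw => ⟨hw.1, (lt_min_iff.1 (show w.re < min r₀ R from hw.2)).2⟩
  have hVmem : V ∈ reAtBot W := (hasBasis_reAtBot W).mem_of_mem trivial
  obtain ⟨w₀, hw₀⟩ := Filter.nonempty_of_mem hVmem
  have hVc : IsPreconnected V := (hW.inter (convex_halfSpace_re_lt _)).isPreconnected
  obtain ⟨z, hz, hwz⟩ := hr₀ (hVr₀ hw₀)
  -- The connected image is covered by disjoint balls, so it stays in the one that it meets.
  have himg : g '' V ⊆ Metric.ball z δ := by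
    have hpre : IsPreconnected (g '' V) := hVc.image _ (hg.mono hVR)
    refine hpre.subset_left_of_subset_union Metric.isOpen_ball
      (isOpen_biUnion (fun z' (_ : z' ∈ {z' | z' ∈ Z ∧ z' ≠ z}) =>
        (Metric.isOpen_ball : IsOpen (Metric.ball z' δ)))) ?_ ?_ ?_
    · refine Set.disjoint_left.2 fun e he he' => ?_
      obtain ⟨z', ⟨hz', hne⟩, hez'⟩ := Set.mem_iUnion₂.1 he'
      refine hne (hsep z' hz' z hz ?_)
      have := dist_triangle_left z' z e
      rw [Metric.mem_ball] at he hez'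
      linarith
    · rintro _ ⟨w, hw, rfl⟩
      obtain ⟨z', hz', hd⟩ := hr₀ (hVr₀ hw)
      by_cases h : z' = z
      · left; rw [← h]; exact hd
      · right; exact Set.mem_iUnion₂.2 ⟨z', ⟨hz', h⟩, hd⟩
    · exact ⟨g w₀, ⟨w₀, hw₀, rfl⟩, hwz⟩
  refine ⟨z, hz, Metric.tendsto_nhds.2 fun ε hε => ?_⟩
  filter_upwards [hVmem, hZ (min ε δ) (lt_min hε hδ)] with w hw hw'
  obtain ⟨z', hz', hd⟩ := hw'
  have h1 : dist (g w) z < δ := himg ⟨w, hw, rfl⟩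
  have : z' = z := by
    refine hsep z' hz' z hz ?_
    have := dist_triangle_left z' z (g w)
    have := hd.trans_le (min_le_right _ _)
    linarith
  rw [← this]
  exact hd.trans_le (min_le_left _ _)

/-! ### Newton polygon and leading terms -/

/-- In a vanishing finite sum of at least one nonzero term, two terms are comparable. -/
theorem exists_comparable_of_sum_eq_zero {ι : Type*} (F : Finset ι) (hF : F.Nonempty)
    (b : ι → ℂ) (hb : ∀ i ∈ F, b i ≠ 0) (hsum : ∑ i ∈ F, b i = 0) :
    ∃ i ∈ F, ∃ j ∈ F, i ≠ j ∧ ‖b j‖ ≤ ‖b i‖ ∧ ‖b i‖ ≤ F.card * ‖b j‖ := by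
  classical
  obtain ⟨i, hi, hmax⟩ := F.exists_max_image (fun i => ‖b i‖) hF
  have hsplit := Finset.add_sum_erase F b hi
  rw [hsum] at hsplit
  have hne : (F.erase i).Nonempty := by
    by_contra h
    rw [Finset.not_nonempty_iff_eq_empty.1 h] at hsplit
    exact hb i hi (by simpa using hsplit)
  obtain ⟨j, hj, hjmax⟩ := (F.erase i).exists_max_image (fun i => ‖b i‖) hne
  refine ⟨i, hi, j, Finset.mem_of_mem_erase hj, (Finset.ne_of_mem_erase hj).symm,
    hmax j (Finset.mem_of_mem_erase hj), ?_⟩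
  have h1 : ‖b i‖ = ‖∑ k ∈ F.erase i, b k‖ := by
    rw [eq_neg_of_add_eq_zero_left hsplit, norm_neg]
  calc ‖b i‖ ≤ ∑ k ∈ F.erase i, ‖b k‖ := h1 ▸ norm_sum_le _ _
    _ ≤ (F.erase i).card • ‖b j‖ := Finset.sum_le_card_nsmul _ _ _ hjmax
    _ ≤ F.card * ‖b j‖ := by
        rw [nsmul_eq_mul]
        gcongr
        exact Finset.erase_subset _ _

/-- Where a nonzero complex polynomial is small, a root is near. -/
theorem exists_root_near {E : Polynomial ℂ} (hE : E ≠ 0) {ε : ℝ} (hε : 0 < ε) :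
    ∃ η > 0, ∀ z : ℂ, ‖E.eval z‖ < η → ∃ r ∈ E.roots.toFinset, dist z r < ε := by
  -- The lower bound for ‖E z‖ given by the factorization when all roots are at distance at least ε.
  refine ⟨‖E.leadingCoeff‖ * ε ^ E.roots.card, ?_, fun z hz => ?_⟩
  · have := norm_pos_iff.2 (Polynomial.leadingCoeff_ne_zero.2 hE)
    positivity
  · by_contra! h
    refine absurd hz (not_lt.2 ?_)
    rw [(IsAlgClosed.splits E).eval_eq_prod_roots, norm_mul]
    gcongr
    have hr : ∀ r ∈ E.roots, ε ≤ ‖z - r‖ := fun r hr => by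
      rw [← dist_eq_norm]; exact h r (Multiset.mem_toFinset.2 hr)
    generalize E.roots = s at hr
    induction s using Multiset.induction_on with
    | empty => simp
    | cons a s ih =>
      rw [Multiset.card_cons, Multiset.map_cons, Multiset.prod_cons, norm_mul, pow_succ']
      exact mul_le_mul (hr a (by simp)) (ih fun r h => hr r (by simp [h])) (by positivity)
        (norm_nonneg _)

/-- Two comparable terms of a vanishing sum `∑ a i j e ^ (i w) y ^ j` put `log ‖y‖` within
bounded distance of one of finitely many rational multiples of `re w`. -/
theorem exists_slope_near (F : Finset (ℕ × ℕ)) (hF : F.Nonempty) (a : ℕ × ℕ → ℂ)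
    (ha : ∀ q ∈ F, a q ≠ 0) :
    ∃ (Q : Finset ℚ) (C : ℝ), ∀ w y : ℂ, w.re < -C → y ≠ 0 →
      ∑ q ∈ F, a q * Complex.exp w ^ q.1 * y ^ q.2 = 0 →
      ∃ p ∈ Q, |Real.log ‖y‖ - p * w.re| ≤ C := by
  classical
  obtain ⟨B, hB⟩ : ∃ B : ℝ, ∀ q ∈ F, |Real.log ‖a q‖| ≤ B := by
    obtain ⟨q, -, hq⟩ := F.exists_max_image (fun q => |Real.log ‖a q‖|) hF
    exact ⟨_, hq⟩
  have hcard : (1 : ℝ) ≤ F.card := by exact_mod_cast hF.card_pos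
  -- The candidates are the slopes of segments between exponents; pairs with equal second entries
  -- only add the harmless value 0. In the constant, 2B bounds the two coefficients and the last
  -- term is the comparability factor.
  refine ⟨(F ×ˢ F).image fun s => -((s.1.1 : ℚ) - s.2.1) / ((s.1.2 : ℚ) - s.2.2),
    2 * B + Real.log F.card, fun w y hw hy hsum => ?_⟩
  obtain ⟨q, hq, q', hq', hne, hle, hle'⟩ := exists_comparable_of_sum_eq_zero F hF _
    (fun q hq => mul_ne_zero (mul_ne_zero (ha q hq) (pow_ne_zero _ (Complex.exp_ne_zero w)))
      (pow_ne_zero _ hy)) hsum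
  set v := Real.log ‖y‖
  have hlog : ∀ q ∈ F, Real.log ‖a q * Complex.exp w ^ q.1 * y ^ q.2‖ =
      Real.log ‖a q‖ + q.1 * w.re + q.2 * v := fun q hq => by
    have h1 : ‖a q‖ ≠ 0 := norm_ne_zero_iff.2 (ha q hq)
    have h2 : ‖y‖ ≠ 0 := norm_ne_zero_iff.2 hy
    rw [norm_mul, norm_mul, norm_pow, norm_pow, Complex.norm_exp,
      Real.log_mul (by positivity) (by positivity), Real.log_mul h1 (by positivity),
      Real.log_pow, Real.log_pow, Real.log_exp]
  have hpos : ∀ q ∈ F, 0 < ‖a q * Complex.exp w ^ q.1 * y ^ q.2‖ := fun q hq =>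
    norm_pos_iff.2 (mul_ne_zero (mul_ne_zero (ha q hq) (pow_ne_zero _ (Complex.exp_ne_zero w)))
      (pow_ne_zero _ hy))
  have h1 := Real.log_le_log (hpos q' hq') hle
  have h2 := Real.log_le_log (hpos q hq) hle'
  rw [Real.log_mul (by positivity) (hpos q' hq').ne', hlog q hq, hlog q' hq'] at h2
  rw [hlog q hq, hlog q' hq'] at h1
  have hlc := Real.log_nonneg hcard
  have hBq := abs_le.1 (hB q hq)
  have hBq' := abs_le.1 (hB q' hq')
  set C := 2 * B + Real.log F.card
  have hkey : |((q.1 : ℝ) - q'.1) * w.re + ((q.2 : ℝ) - q'.2) * v| ≤ C := by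
    rw [abs_le]
    constructor <;> linarith
  have hC : 0 ≤ C := (abs_nonneg _).trans hkey
  have int_abs : ∀ i j : ℕ, i ≠ j → (1 : ℝ) ≤ |(i : ℝ) - j| := fun i j h => by
    have : (1 : ℤ) ≤ |(i : ℤ) - j| := Int.one_le_abs (sub_ne_zero.2 (by exact_mod_cast h))
    exact_mod_cast this
  -- With equal powers of y, distinct powers of e^w would differ in log-size by at least |re w| > C.
  have hj : q.2 ≠ q'.2 := by
    intro hj
    have hi : q.1 ≠ q'.1 := fun hi => hne (Prod.ext hi hj)
    rw [hj, sub_self, zero_mul, add_zero, abs_mul] at hkey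
    have h3 := int_abs _ _ hi
    have h4 : C < |w.re| := by
      rw [abs_of_neg (by linarith)]; linarith
    nlinarith [abs_nonneg w.re]
  have hj0 : ((q.2 : ℝ) - q'.2) ≠ 0 := sub_ne_zero.2 (by exact_mod_cast hj)
  refine ⟨_, Finset.mem_image_of_mem _ (Finset.mk_mem_product hq hq'), ?_⟩
  have h3 := int_abs _ _ hj
  have h4 : ((q.1 : ℝ) - q'.1) * w.re + ((q.2 : ℝ) - q'.2) * v =
      ((q.2 : ℝ) - q'.2) * (v - ((-((q.1 : ℚ) - q'.1) / ((q.2 : ℚ) - q'.2) : ℚ) : ℝ) * w.re) := by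
    push_cast
    field_simp
    ring
  rw [h4, abs_mul] at hkey
  exact (le_mul_of_one_le_left (abs_nonneg _) h3).trans hkey

/-- `exists_leading_term` for a vanishing sum given by its finite set of exponents. -/
theorem exists_leading_term_of_sum {W : Set ℂ} (hW : Convex ℝ W) [(reAtBot W).NeBot]
    {D : ℂ → ℂ} (hD : ContinuousOn D W) (hD0 : ∀ w ∈ W, D w ≠ 0)
    (F : Finset (ℕ × ℕ)) (hF : F.Nonempty) (a : ℕ × ℕ → ℂ) (ha : ∀ q ∈ F, a q ≠ 0)
    (hsum : ∀ w ∈ W, ∑ q ∈ F, a q * Complex.exp w ^ q.1 * D w ^ q.2 = 0) :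
    ∃ (p : ℚ) (c : ℂ), c ≠ 0 ∧
      Tendsto (fun w => D w * Complex.exp (-(p * w))) (reAtBot W) (𝓝 c) := by
  classical
  obtain ⟨Q, C, hQ⟩ := exists_slope_near F hF a ha
  have hre := tendsto_re_reAtBot W
  have hnear : ∀ᶠ w in reAtBot W, ∃ p ∈ Q, |Real.log ‖D w‖ - p * w.re| ≤ C := by
    filter_upwards [eventually_mem_reAtBot W, hre.eventually (eventually_lt_atBot (-C))]
      with w hw hwC
    exact hQ w (D w) hwC (hD0 w hw) (hsum w hw)
  have hlogc : ContinuousOn (fun w => Real.log ‖D w‖) W :=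
    hD.norm.log fun w hw => norm_ne_zero_iff.2 (hD0 w hw)
  have hquot : ∀ p : ℚ, ∀ w : ℂ, w.re < 0 → |Real.log ‖D w‖ - p * w.re| ≤ C →
      dist (Real.log ‖D w‖ / w.re) p ≤ C / |w.re| := fun p w hw h => by
    have h1 : Real.log ‖D w‖ / w.re - p = (Real.log ‖D w‖ - p * w.re) / w.re := by
      have := hw.ne
      field_simp
    rw [Real.dist_eq, h1, abs_div]
    gcongr
  have hCu : Tendsto (fun w : ℂ => C / |w.re|) (reAtBot W) (𝓝 0) :=
    tendsto_const_nhds.div_atTop (tendsto_abs_atBot_atTop.comp hre)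
  -- Division by re w turns bounded distance into vanishing distance, so the quotient selects one
  -- slope; `R := 0` keeps the denominator nonzero.
  obtain ⟨p', hp', hlim⟩ := exists_tendsto_of_near_finset (R := 0) hW
    (g := fun w => Real.log ‖D w‖ / w.re)
    ((hlogc.mono Set.inter_subset_left).div Complex.continuous_re.continuousOn
      fun w hw => (show w.re < 0 from hw.2).ne) (Q.image fun p : ℚ => (p : ℝ)) fun ε hε => by
      filter_upwards [hnear, hCu.eventually (gt_mem_nhds hε),
        hre.eventually (eventually_lt_atBot 0)] with w ⟨p, hp, hpw⟩ hw hw0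
      exact ⟨p, Finset.mem_image_of_mem _ hp, (hquot p w hw0 hpw).trans_lt hw⟩
  obtain ⟨p, hp, rfl⟩ := Finset.mem_image.1 hp'
  -- The limit alone gives an error o(re w). The bound `C` returns because every other slope is
  -- eventually excluded, so the slope in `hnear` must be `p`.
  have hclose : ∀ᶠ w in reAtBot W, |Real.log ‖D w‖ - p * w.re| ≤ C := by
    have hsep : ∀ᶠ w in reAtBot W, ∀ p' ∈ Q, p' ≠ p →
        C / |w.re| < dist (Real.log ‖D w‖ / w.re) p' := by
      refine (Finset.eventually_all Q).2 fun p' _ => ?_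
      by_cases h : p' = p
      · simp [h]
      · have hpos : (0 : ℝ) < dist (p : ℝ) p' :=
          dist_pos.2 fun h' => h (by exact_mod_cast h'.symm)
        filter_upwards [hCu.eventually_lt (hlim.dist tendsto_const_nhds) hpos] with w hw _
        exact hw
    filter_upwards [hnear, hsep, hre.eventually (eventually_lt_atBot 0)]
      with w ⟨p', hp', hpw⟩ hw hw0
    by_cases h : p' = p
    · exact h ▸ hpw
    · exact absurd (hquot p' w hw0 hpw) (not_le.2 (hw p' hp' h))
  set g : ℂ → ℂ := fun w => D w * Complex.exp (-(p * w)) with hg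
  have hgn : ∀ w ∈ W, ‖g w‖ = Real.exp (Real.log ‖D w‖ - p * w.re) := fun w hw => by
    have h1 : (-((p : ℂ) * w)).re = -(p * w.re) := by
      rw [Complex.neg_re, ← Complex.ofReal_ratCast, Complex.re_ofReal_mul]
    rw [hg, norm_mul, Complex.norm_exp, h1, sub_eq_add_neg, Real.exp_add,
      Real.exp_log (norm_pos_iff.2 (hD0 w hw))]
  have hgbd : ∀ᶠ w in reAtBot W, Real.exp (-C) ≤ ‖g w‖ ∧ ‖g w‖ ≤ Real.exp C := by
    filter_upwards [hclose, eventually_mem_reAtBot W] with w h hw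
    rw [hgn w hw, Real.exp_le_exp, Real.exp_le_exp]
    exact abs_le.1 h
  -- `e q` is the exponent of e^w in the term `q` once D = g e^(pw) is substituted. The terms of
  -- least exponent form the edge polynomial `E`.
  set e : ℕ × ℕ → ℚ := fun q => q.1 + p * q.2 with he
  obtain ⟨q₀, hq₀, hmin⟩ := F.exists_min_image e hF
  set E : Polynomial ℂ := ∑ q ∈ F with e q = e q₀, Polynomial.monomial q.2 (a q) with hE
  -- On the edge, `q.2` determines `q.1`, so no coefficients merge or cancel.
  have hE0 : E ≠ 0 := by
    intro h
    have h1 : E.coeff q₀.2 = a q₀ := by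
      rw [hE, Polynomial.finsetSum_coeff, Finset.sum_eq_single q₀]
      · simp
      · intro q hq hne
        rw [Polynomial.coeff_monomial, if_neg]
        intro h2
        have h3 := (Finset.mem_filter.1 hq).2
        simp only [he, h2, add_left_inj, Nat.cast_inj] at h3
        exact hne (Prod.ext h3 h2)
      · intro h; simp [hq₀] at h
    rw [h, Polynomial.coeff_zero] at h1
    exact ha q₀ hq₀ h1.symm
  have hscaled : ∀ w ∈ W,
      ∑ q ∈ F, a q * Complex.exp ((e q - e q₀ : ℚ) * w) * g w ^ q.2 = 0 := fun w hw => by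
    have h1 : ∀ q ∈ F, a q * Complex.exp ((e q - e q₀ : ℚ) * w) * g w ^ q.2 =
        (a q * Complex.exp w ^ q.1 * D w ^ q.2) * Complex.exp (-(e q₀ * w)) := fun q _ => by
      have h2 : Complex.exp ((e q - e q₀ : ℚ) * w) * Complex.exp (-(p * w)) ^ q.2 =
          Complex.exp w ^ q.1 * Complex.exp (-(e q₀ * w)) := by
        rw [← Complex.exp_nat_mul, ← Complex.exp_nat_mul, ← Complex.exp_add, ← Complex.exp_add]
        congr 1
        simp only [he]
        push_cast
        ring
      rw [hg]
      simp only [mul_pow]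
      linear_combination (a q * D w ^ q.2) * h2
    rw [Finset.sum_congr rfl h1, ← Finset.sum_mul, hsum w hw, zero_mul]
  have hEeval : ∀ w ∈ W, E.eval (g w) =
      -∑ q ∈ F with e q ≠ e q₀, a q * Complex.exp ((e q - e q₀ : ℚ) * w) * g w ^ q.2 :=
    fun w hw => by
    have h1 := hscaled w hw
    rw [← Finset.sum_filter_add_sum_filter_not F (fun q => e q = e q₀)] at h1
    rw [eq_neg_iff_add_eq_zero, ← h1, hE, Polynomial.eval_finsetSum]
    congr 1
    refine Finset.sum_congr rfl fun q hq => ?_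
    rw [(Finset.mem_filter.1 hq).2, Polynomial.eval_monomial]
    simp
  -- Off the edge the exponent of e^w is positive after rescaling and `g` is bounded, so those terms
  -- vanish in the limit.
  have hElim : Tendsto (fun w => E.eval (g w)) (reAtBot W) (𝓝 0) := by
    have h1 : Tendsto (fun w => -∑ q ∈ F with e q ≠ e q₀,
        a q * Complex.exp ((e q - e q₀ : ℚ) * w) * g w ^ q.2) (reAtBot W) (𝓝 0) := by
      rw [← neg_zero, ← Finset.sum_const_zero (s := F.filter fun q => e q ≠ e q₀)]
      refine (tendsto_finsetSum _ fun q hq => ?_).neg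
      have hlt : e q₀ < e q :=
        lt_of_le_of_ne (hmin q (Finset.mem_filter.1 hq).1) (Finset.mem_filter.1 hq).2.symm
      have hlt' : (0 : ℝ) < ((e q - e q₀ : ℚ) : ℝ) := by exact_mod_cast sub_pos.2 hlt
      have h2 : Tendsto (fun w : ℂ => ‖a q‖ * Real.exp (((e q - e q₀ : ℚ) : ℝ) * w.re) *
          Real.exp C ^ q.2) (reAtBot W) (𝓝 0) := by
        have := (((Real.tendsto_exp_atBot.comp (hre.const_mul_atBot hlt')).const_mul
          ‖a q‖).mul_const (Real.exp C ^ q.2))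
        simpa using this
      refine squeeze_zero_norm' ?_ h2
      filter_upwards [hgbd] with w hw
      rw [norm_mul, norm_mul, norm_pow, Complex.norm_exp, ← Complex.ofReal_ratCast,
        Complex.re_ofReal_mul]
      gcongr
      exact hw.2
    refine h1.congr' ?_
    filter_upwards [eventually_mem_reAtBot W] with w hw
    exact (hEeval w hw).symm
  have hgc : ContinuousOn g (W ∩ {w | w.re < 0}) :=
    (hD.mono Set.inter_subset_left).mul (by fun_prop)
  obtain ⟨c, -, hc⟩ := exists_tendsto_of_near_finset hW hgc E.roots.toFinset fun ε hε => by
    obtain ⟨η, hη, h⟩ := exists_root_near hE0 hε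
    filter_upwards [hElim.norm.eventually (gt_mem_nhds (by simpa using hη))] with w hw
    exact h _ hw
  refine ⟨p, c, ?_, hc⟩
  have h1 : Real.exp (-C) ≤ ‖c‖ := ge_of_tendsto hc.norm (hgbd.mono fun w hw => hw.1)
  exact norm_pos_iff.1 ((Real.exp_pos _).trans_le h1)

/-- The support of a polynomial in two variables as a finite set of pairs of exponents. -/
theorem exists_finset_sum_of_bivariate (P : Polynomial (Polynomial ℂ)) (hP : P ≠ 0) :
    ∃ (F : Finset (ℕ × ℕ)) (a : ℕ × ℕ → ℂ), F.Nonempty ∧ (∀ q ∈ F, a q ≠ 0) ∧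
      ∀ s y : ℂ, P.evalEval s y = ∑ q ∈ F, a q * s ^ q.1 * y ^ q.2 := by
  classical
  set N := P.support.sup fun j => (P.coeff j).natDegree
  set a : ℕ × ℕ → ℂ := fun q => (P.coeff q.2).coeff q.1 with ha
  have hN : ∀ j, (P.coeff j).natDegree < N + 1 := fun j => by
    by_cases hj : j ∈ P.support
    · exact Nat.lt_succ_of_le (Finset.le_sup (f := fun j => (P.coeff j).natDegree) hj)
    · simp [Polynomial.notMem_support_iff.1 hj]
  refine ⟨(Finset.range (N + 1) ×ˢ Finset.range (P.natDegree + 1)).filter fun q => a q ≠ 0, a,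
    ?_, fun q hq => (Finset.mem_filter.1 hq).2, fun s y => ?_⟩
  · refine ⟨(P.leadingCoeff.natDegree, P.natDegree), Finset.mem_filter.2 ⟨?_, ?_⟩⟩
    · rw [Finset.mem_product]
      exact ⟨Finset.mem_range.2 (hN _), Finset.self_mem_range_succ _⟩
    · exact Polynomial.leadingCoeff_ne_zero.2 (Polynomial.leadingCoeff_ne_zero.2 hP)
  · rw [Finset.sum_filter_of_ne, Finset.sum_product_right, Polynomial.evalEval,
      Polynomial.eval_eq_sum_range (p := P), Polynomial.eval_finsetSum]
    · refine Finset.sum_congr rfl fun j _ => ?_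
      rw [Polynomial.eval_mul, Polynomial.eval_pow, Polynomial.eval_C,
        Polynomial.eval_eq_sum_range' (hN j), Finset.sum_mul]
    · intro q _ h h0
      simp [h0] at h

/-- If `P (e ^ w, D w) = 0` with `D` continuous and nowhere zero on a convex set, then `D` has
leading term `c e ^ (p w)` with a rational exponent as the real part of `w` tends to `-∞`. -/
theorem exists_leading_term {W : Set ℂ} (hW : Convex ℝ W) [(reAtBot W).NeBot]
    {D : ℂ → ℂ} (hD : ContinuousOn D W) (hD0 : ∀ w ∈ W, D w ≠ 0)
    {P : Polynomial (Polynomial ℂ)} (hP : P ≠ 0)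
    (hPD : ∀ w ∈ W, P.evalEval (Complex.exp w) (D w) = 0) :
    ∃ (p : ℚ) (c : ℂ), c ≠ 0 ∧
      Tendsto (fun w => D w * Complex.exp (-(p * w))) (reAtBot W) (𝓝 c) := by
  obtain ⟨F, a, hF, ha, hFa⟩ := exists_finset_sum_of_bivariate P hP
  exact exists_leading_term_of_sum hW hD hD0 F hF a ha fun w hw => by rw [← hFa, hPD w hw]

/-! ### Jacobian criterion and algebraicity -/

/-- The chain rule for derivations of a polynomial ring. -/
theorem derivation_mvPolynomial_eq_sum {n : ℕ} {R M : Type*} [CommRing R] [AddCommGroup M]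
    [Module R M] [Module (MvPolynomial (Fin n) R) M] [IsScalarTower R (MvPolynomial (Fin n) R) M]
    (D : Derivation R (MvPolynomial (Fin n) R) M) (q : MvPolynomial (Fin n) R) :
    D q = ∑ j, MvPolynomial.pderiv j q • D (MvPolynomial.X j) := by
  classical
  induction q using MvPolynomial.induction_on with
  | C r => simp
  | add q q' hq hq' => simp only [map_add, hq, hq', add_smul, Finset.sum_add_distrib]
  | mul_X q i hq =>
    simp only [Derivation.leibniz, hq, MvPolynomial.pderiv_X, add_smul, Finset.sum_add_distrib,
      Finset.smul_sum, smul_smul, smul_eq_mul]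
    simp [Pi.single_apply]

/-- The Jacobian matrix of a square system of polynomials over any ring. -/
noncomputable def systemJacobian {n : ℕ} {R : Type*} [CommRing R]
    (G : Fin n → MvPolynomial (Fin n) R) : Matrix (Fin n) (Fin n) (MvPolynomial (Fin n) R) :=
  Matrix.of fun i j => MvPolynomial.pderiv j (G i)

/-- The Jacobian criterion: the zero scheme of a square system, with the zeros of the Jacobian
determinant removed, is formally unramified over the base. -/
theorem formallyUnramified_of_isUnit_jacobian {n : ℕ} {R S : Type*} [CommRing R] [CommRing S]
    [Algebra R S] [Algebra (MvPolynomial (Fin n) R) S] [IsScalarTower R (MvPolynomial (Fin n) R) S]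
    (G : Fin n → MvPolynomial (Fin n) R) (hG : ∀ i, algebraMap _ S (G i) = 0)
    (hJ : IsUnit (algebraMap _ S (systemJacobian G).det))
    (hS : ∀ s : S, ∃ (N : ℕ) (q : MvPolynomial (Fin n) R),
      s * algebraMap _ S (systemJacobian G).det ^ N = algebraMap _ S q) :
    Algebra.FormallyUnramified R S := by
  set D := KaehlerDifferential.D R S with hD
  set D' : Derivation R (MvPolynomial (Fin n) R) (Ω[S⁄R]) :=
    D.compAlgebraMap (MvPolynomial (Fin n) R) with hD'
  have hD'D : ∀ q, D' q = D (algebraMap _ S q) := fun q => rfl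
  have hX : ∀ j, D' (MvPolynomial.X j) = 0 := fun j => by
    have h1 : ∀ i, ∑ j, systemJacobian G i j • D' (MvPolynomial.X j) = 0 := fun i => by
      have := derivation_mvPolynomial_eq_sum D' (G i)
      rw [hD'D, hG, map_zero] at this
      exact this.symm
    -- Differentiating G = 0 gives J · dX = 0; the adjugate turns this into det J · dX = 0.
    have h2 : (systemJacobian G).det • D' (MvPolynomial.X j) = 0 := by
      calc (systemJacobian G).det • D' (MvPolynomial.X j)
          = ∑ k, ((systemJacobian G).adjugate * systemJacobian G) j k •
              D' (MvPolynomial.X k) := by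
            rw [Matrix.adjugate_mul]
            simp [Matrix.smul_apply, Matrix.one_apply]
        _ = ∑ i, (systemJacobian G).adjugate j i •
              ∑ k, systemJacobian G i k • D' (MvPolynomial.X k) := by
            simp only [Matrix.mul_apply, Finset.sum_smul, Finset.smul_sum, smul_smul]
            exact Finset.sum_comm
        _ = 0 := by simp [h1]
    rw [← algebraMap_smul S] at h2
    exact (hJ.smul_eq_zero).1 h2
  have hq : ∀ q, D (algebraMap _ S q) = 0 := fun q => by
    rw [← hD'D, derivation_mvPolynomial_eq_sum D' q]
    simp [hX]
  -- `s` is a polynomial divided by a power of det J, and both have zero differential.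
  have hs : ∀ s, D s = 0 := fun s => by
    obtain ⟨N, q, h⟩ := hS s
    have h1 := hq q
    rw [← h, ← map_pow, D.leibniz, hq, smul_zero, zero_add, map_pow] at h1
    exact ((hJ.pow N).smul_eq_zero).1 h1
  refine ⟨?_⟩
  rw [← Submodule.subsingleton_iff S, ← subsingleton_iff_bot_eq_top,
    ← KaehlerDifferential.span_range_derivation R S, eq_comm, Submodule.span_eq_bot]
  rintro _ ⟨s, rfl⟩
  exact hs s

/-- An element of a formally unramified algebra of finite type over a domain satisfies a
polynomial equation over the domain. -/
theorem isAlgebraic_of_formallyUnramified {R S : Type*} [CommRing R] [IsDomain R] [CommRing S]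
    [Algebra R S] [Algebra.FiniteType R S] [Algebra.FormallyUnramified R S] (s : S) :
    IsAlgebraic R s := by
  let K := FractionRing R
  -- Over a field, an unramified algebra of finite type is finite-dimensional.
  have hfin : Module.Finite K (TensorProduct R K S) :=
    Algebra.FormallyUnramified.finite_of_free K (TensorProduct R K S)
  let t : TensorProduct R K S := Algebra.TensorProduct.includeRight s
  have ht : IsAlgebraic R t :=
    (IsFractionRing.isAlgebraic_iff R K _).2 (Algebra.IsIntegral.isIntegral (R := K) t).isAlgebraic
  obtain ⟨P, hP, hPt⟩ := ht
  have h1 : (TensorProduct.mk R K S 1) (Polynomial.aeval s P) = 0 := by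
    rw [← hPt]
    exact (Polynomial.aeval_algHom_apply
      (Algebra.TensorProduct.includeRight : S →ₐ[R] TensorProduct R K S) s P).symm
  -- The relation holds only after localization; a nonzero `r` clears the kernel of S → K ⊗ S.
  obtain ⟨r, hr⟩ := (IsLocalizedModule.eq_zero_iff (nonZeroDivisors R)
    (TensorProduct.mk R K S 1)).1 h1
  refine ⟨Polynomial.C (r : R) * P,
    mul_ne_zero (Polynomial.C_ne_zero.2 (nonZeroDivisors.ne_zero r.2)) hP, ?_⟩
  rw [map_mul, Polynomial.aeval_C, ← Algebra.smul_def]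
  exact hr

/-- One nonzero polynomial over the base is satisfied by the Jacobian determinant at all regular
zeros of a square system. -/
theorem exists_relation_of_system {n : ℕ} {R : Type*} [CommRing R] [IsDomain R]
    (G : Fin n → MvPolynomial (Fin n) R) :
    ∃ P : Polynomial R, P ≠ 0 ∧ ∀ {A : Type} [Field A] (φ : MvPolynomial (Fin n) R →+* A),
      (∀ i, φ (G i) = 0) → φ (systemJacobian G).det ≠ 0 →
        P.eval₂ (φ.comp MvPolynomial.C) (φ (systemJacobian G).det) = 0 := by
  set J := (systemJacobian G).det with hJ
  set I := Ideal.span (Set.range G) with hI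
  let S := Localization.Away (Ideal.Quotient.mk I J)
  have hmap : ∀ q, algebraMap (MvPolynomial (Fin n) R) S q =
    algebraMap (MvPolynomial (Fin n) R ⧸ I) S (Ideal.Quotient.mk I q) := fun q => rfl
  have hunr : Algebra.FormallyUnramified R S := by
    refine formallyUnramified_of_isUnit_jacobian G (fun i => ?_) ?_ fun s => ?_
    · rw [hmap, Ideal.Quotient.eq_zero_iff_mem.2 (Ideal.subset_span (Set.mem_range_self i)), map_zero]
    · rw [hmap]
      exact IsLocalization.Away.algebraMap_isUnit _
    · obtain ⟨N, a, h⟩ := IsLocalization.Away.surj (Ideal.Quotient.mk I J) s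
      obtain ⟨q, rfl⟩ := Ideal.Quotient.mk_surjective a
      exact ⟨N, q, h⟩
  obtain ⟨P, hP, hPJ⟩ := isAlgebraic_of_formallyUnramified (R := R)
    (algebraMap (MvPolynomial (Fin n) R) S J)
  refine ⟨P, hP, fun {A} _ φ hφ hφJ => ?_⟩
  have hIφ : ∀ a ∈ I, φ a = 0 := by
    have : I ≤ RingHom.ker φ := by
      rw [hI, Ideal.span_le]
      rintro _ ⟨i, rfl⟩
      exact hφ i
    exact this
  -- Every regular zero is a point of `S`, which is why the one relation found in `S` serves them
  -- all.
  let ψ : S →+* A := IsLocalization.Away.lift (Ideal.Quotient.mk I J)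
    (g := Ideal.Quotient.lift I φ hIφ) (by simpa using hφJ)
  have hψ : ∀ q, ψ (algebraMap _ S q) = φ q := fun q => by
    rw [hmap]
    simp only [ψ, IsLocalization.Away.lift_eq, Ideal.Quotient.lift_mk]
  have h1 := congrArg ψ hPJ
  rw [map_zero, Polynomial.aeval_def, Polynomial.hom_eval₂, hψ] at h1
  have h2 : ψ.comp (algebraMap R S) = φ.comp MvPolynomial.C := RingHom.ext fun r => by
    rw [RingHom.comp_apply, RingHom.comp_apply, ← hψ,
      IsScalarTower.algebraMap_apply R (MvPolynomial (Fin n) R) S, MvPolynomial.algebraMap_eq]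
  rwa [h2] at h1

/-! ### Specialization to the homotopy -/

theorem det_jacobian_ne_zero_iff {n m : ℕ} (f : PolySystem n m) (x : Fin n → ℂ)
    (lam : Fin m → ℂ) : (jacobian f x lam).det ≠ 0 ↔ ¬ IsSingularPoint f x lam := by
  rw [IsSingularPoint, not_lt, ← isUnit_iff_ne_zero, ← Matrix.isUnit_iff_isUnit_det]
  refine ⟨fun h => ?_, fun h => ?_⟩
  · rw [Matrix.rank_of_isUnit _ h, Fintype.card_fin]
  · rw [← Matrix.linearIndependent_rows_iff_isUnit, linearIndependent_iff_card_eq_finrank_span,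
      Fintype.card_fin, Set.finrank, ← Matrix.rank_eq_finrank_span_row]
    exact le_antisymm h ((Matrix.rank_le_width _))

theorem continuousOn_det_jacobian {n m : ℕ} (f : PolySystem n m) {Y : Type*} [TopologicalSpace Y]
    {S : Set Y} {X : Y → Fin n → ℂ} {L : Y → Fin m → ℂ} (hX : ContinuousOn X S)
    (hL : ContinuousOn L S) : ContinuousOn (fun y => (jacobian f (X y) (L y)).det) S := by
  rw [continuousOn_iff_continuous_domRestrict] at hX hL ⊢
  refine Continuous.matrix_det (continuous_matrix fun i j => ?_)
  refine (MvPolynomial.continuous_eval _).comp (continuous_pi fun s => ?_)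
  rcases s with s | s
  · exact (continuous_apply s).comp hX
  · exact (continuous_apply s).comp hL

/-- Substitution of `(1 - t) lam₀ + t lam₁` with `t = a + b s` for the parameters, where `s` is the
variable of the coefficient ring. -/
noncomputable def substParam {n m : ℕ} (lam₀ lam₁ : Fin m → ℂ) (a b : ℂ) :
    MvPolynomial (Fin n ⊕ Fin m) ℂ →ₐ[ℂ] MvPolynomial (Fin n) (Polynomial ℂ) :=
  MvPolynomial.aeval (Sum.elim MvPolynomial.X fun l => MvPolynomial.C
    ((1 - (Polynomial.C a + Polynomial.C b * Polynomial.X)) * Polynomial.C (lam₀ l) +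
      (Polynomial.C a + Polynomial.C b * Polynomial.X) * Polynomial.C (lam₁ l)))

theorem substParam_C {n m : ℕ} (lam₀ lam₁ : Fin m → ℂ) (a b r : ℂ) :
    substParam (n := n) lam₀ lam₁ a b (MvPolynomial.C r) = MvPolynomial.C (Polynomial.C r) := by
  rw [← MvPolynomial.algebraMap_eq, AlgHom.commutes]
  rfl

theorem substParam_X_inl {n m : ℕ} (lam₀ lam₁ : Fin m → ℂ) (a b : ℂ) (i : Fin n) :
    substParam lam₀ lam₁ a b (MvPolynomial.X (Sum.inl i)) = MvPolynomial.X i :=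
  MvPolynomial.aeval_X _ _

theorem substParam_X_inr {n m : ℕ} (lam₀ lam₁ : Fin m → ℂ) (a b : ℂ) (l : Fin m) :
    substParam (n := n) lam₀ lam₁ a b (MvPolynomial.X (Sum.inr l)) = MvPolynomial.C
      ((1 - (Polynomial.C a + Polynomial.C b * Polynomial.X)) * Polynomial.C (lam₀ l) +
        (Polynomial.C a + Polynomial.C b * Polynomial.X) * Polynomial.C (lam₁ l)) :=
  MvPolynomial.aeval_X _ _

/-- The parameters are sent into the coefficient ring, which ∂/∂x_j kills; so the x-Jacobian of the
substituted system is the substituted Jacobian. -/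
theorem pderiv_substParam {n m : ℕ} (lam₀ lam₁ : Fin m → ℂ) (a b : ℂ)
    (q : MvPolynomial (Fin n ⊕ Fin m) ℂ) (j : Fin n) :
    MvPolynomial.pderiv j (substParam lam₀ lam₁ a b q) =
      substParam lam₀ lam₁ a b (MvPolynomial.pderiv (Sum.inl j) q) := by
  classical
  induction q using MvPolynomial.induction_on with
  | C r => rw [substParam_C, MvPolynomial.pderiv_C, MvPolynomial.pderiv_C, map_zero]
  | add q q' hq hq' => rw [map_add, map_add, map_add, map_add, hq, hq']
  | mul_X q i hq =>
    have hX : MvPolynomial.pderiv j (substParam lam₀ lam₁ a b (MvPolynomial.X i)) =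
        substParam lam₀ lam₁ a b (MvPolynomial.pderiv (Sum.inl j) (MvPolynomial.X i)) := by
      rcases i with i | i
      · rw [substParam_X_inl, MvPolynomial.pderiv_X, MvPolynomial.pderiv_X, Pi.single_apply,
          Pi.single_apply]
        simp only [Sum.inl.injEq]
        split_ifs
        · rw [map_one]
        · rw [map_zero]
      · rw [substParam_X_inr, MvPolynomial.pderiv_C, MvPolynomial.pderiv_X,
          Pi.single_eq_of_ne (by simp), map_zero]
    rw [map_mul, Derivation.leibniz, Derivation.leibniz, map_add, smul_eq_mul, smul_eq_mul,
      smul_eq_mul, smul_eq_mul, map_mul, map_mul, hX, hq]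

theorem eval_substParam {n m : ℕ} (lam₀ lam₁ : Fin m → ℂ) (a b s : ℂ) (x : Fin n → ℂ)
    (lam : Fin m → ℂ) (hlam : lam = (1 - (a + b * s)) • lam₀ + (a + b * s) • lam₁)
    (q : MvPolynomial (Fin n ⊕ Fin m) ℂ) :
    MvPolynomial.eval₂Hom (Polynomial.evalRingHom s) x (substParam lam₀ lam₁ a b q) =
      MvPolynomial.eval (Sum.elim x lam) q := by
  induction q using MvPolynomial.induction_on with
  | C r => rw [substParam_C, MvPolynomial.eval₂Hom_C, MvPolynomial.eval_C]; simp
  | add q q' hq hq' => rw [map_add, map_add, map_add, hq, hq']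
  | mul_X q i hq =>
    rw [map_mul (substParam lam₀ lam₁ a b), RingHom.map_mul, RingHom.map_mul, hq,
      MvPolynomial.eval_X]
    refine congrArg _ ?_
    rcases i with i | i
    · rw [substParam_X_inl, MvPolynomial.eval₂Hom_X', Sum.elim_inl]
    · rw [substParam_X_inr, MvPolynomial.eval₂Hom_C, Sum.elim_inr, hlam]
      simp

/-- One nonzero polynomial relates the time and the Jacobian determinant at all regular solutions
of the homotopy. -/
theorem exists_relation_det_jacobian {n m : ℕ} (f : PolySystem n m) (lam₀ lam₁ : Fin m → ℂ)
    (a b : ℂ) : ∃ P : Polynomial (Polynomial ℂ), P ≠ 0 ∧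
      ∀ (x : Fin n → ℂ) (lam : Fin m → ℂ) (s : ℂ),
        homotopy f lam₀ lam₁ x lam (a + b * s) = 0 → ¬ IsSingularPoint f x lam →
          P.evalEval s (jacobian f x lam).det = 0 := by
  obtain ⟨P, hP, h⟩ := exists_relation_of_system fun i => substParam lam₀ lam₁ a b (f i)
  refine ⟨P, hP, fun x lam s hsol hreg => ?_⟩
  have hval : value f x lam = 0 := congrArg Prod.fst hsol
  -- The second component of the homotopy is affine in `lam` with linear part the identity, so it
  -- determines `lam` from the time.
  have hlam : lam = (1 - (a + b * s)) • lam₀ + (a + b * s) • lam₁ := by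
    have h1 : (1 - (a + b * s)) • (lam - lam₀) + (a + b * s) • (lam - lam₁) = 0 :=
      congrArg Prod.snd hsol
    rw [← sub_eq_zero, ← h1]
    module
  set φ := MvPolynomial.eval₂Hom (Polynomial.evalRingHom s) x
  have hdet : φ (systemJacobian fun i => substParam lam₀ lam₁ a b (f i)).det =
      (jacobian f x lam).det := by
    rw [RingHom.map_det]
    congr 1
    ext i j
    simp only [RingHom.mapMatrix_apply, Matrix.map_apply, systemJacobian, Matrix.of_apply,
      pderiv_substParam, jacobian]
    exact eval_substParam lam₀ lam₁ a b s x lam hlam _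
  have h1 := h φ (fun i => (eval_substParam lam₀ lam₁ a b s x lam hlam _).trans (congrFun hval i))
    (by rw [hdet]; exact (det_jacobian_ne_zero_iff f x lam).2 hreg)
  have h2 : φ.comp MvPolynomial.C = Polynomial.evalRingHom s :=
    RingHom.ext fun r => by simp [φ]
  rwa [hdet, h2, Polynomial.eval₂_evalRingHom] at h1

/-! ### Leading terms on the real line -/

/-- As `u → -∞`, the function `D` has the leading term `c e ^ (p u)`. -/
def HasLeadingTerm (D : ℝ → ℂ) (p : ℚ) (c : ℂ) : Prop :=
  c ≠ 0 ∧ Tendsto (fun u : ℝ => D u * Complex.exp (-(p * u))) atBot (𝓝 c)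

theorem tendsto_exp_mul_atBot {r : ℝ} (hr : 0 < r) :
    Tendsto (fun u : ℝ => Complex.exp (r * u)) atBot (𝓝 0) := by
  rw [tendsto_zero_iff_norm_tendsto_zero]
  refine (Real.tendsto_exp_atBot.comp (tendsto_id.const_mul_atBot hr)).congr fun u => ?_
  simp [Complex.norm_exp]

/-- If p < p', then D e^(-pu) = D e^(-p'u) · e^((p'-p)u) would tend to 0, against c ≠ 0. -/
theorem HasLeadingTerm.le {D : ℝ → ℂ} {p p' : ℚ} {c c' : ℂ} (h : HasLeadingTerm D p c)
    (h' : HasLeadingTerm D p' c') : p' ≤ p := by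
  by_contra! hlt
  have hpos : (0 : ℝ) < ((p' - p : ℚ) : ℝ) := by exact_mod_cast sub_pos.2 hlt
  have h1 := h'.2.mul (tendsto_exp_mul_atBot hpos)
  rw [mul_zero] at h1
  refine h.1 (tendsto_nhds_unique h.2 (h1.congr fun u => ?_))
  rw [mul_assoc, ← Complex.exp_add]
  congr 2
  push_cast
  ring

theorem HasLeadingTerm.unique {D : ℝ → ℂ} {p p' : ℚ} {c c' : ℂ} (h : HasLeadingTerm D p c)
    (h' : HasLeadingTerm D p' c') : p = p' ∧ c = c' := by
  obtain rfl : p = p' := le_antisymm (h'.le h) (h.le h')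
  exact ⟨rfl, tendsto_nhds_unique h.2 h'.2⟩

/-- For p ≤ 0 the factor e^(-pu) is bounded by 1 when u ≤ 0, so the limit c would be 0. -/
theorem HasLeadingTerm.pos {D : ℝ → ℂ} {p : ℚ} {c : ℂ} (h : HasLeadingTerm D p c)
    (hD : Tendsto D atBot (𝓝 0)) : 0 < p := by
  by_contra! hp
  have hp' : (p : ℝ) ≤ 0 := by exact_mod_cast hp
  refine h.1 (tendsto_nhds_unique h.2 (squeeze_zero_norm' ?_
    (tendsto_zero_iff_norm_tendsto_zero.1 hD)))
  filter_upwards [eventually_le_atBot 0] with u hu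
  rw [norm_mul, Complex.norm_exp]
  refine mul_le_of_le_one_right (norm_nonneg _) (Real.exp_le_one_iff.2 ?_)
  have h1 : (-((p : ℂ) * u)).re = -(p * u) := by
    rw [Complex.neg_re, ← Complex.ofReal_ratCast, Complex.re_ofReal_mul, Complex.ofReal_re]
  rw [h1]
  nlinarith

theorem tendsto_line_reAtBot {W : Set ℂ} (b : ℂ) (hW : ∀ᶠ u : ℝ in atBot, (u : ℂ) + b ∈ W) :
    Tendsto (fun u : ℝ => (u : ℂ) + b) atBot (reAtBot W) := by
  refine tendsto_inf.2 ⟨tendsto_comap_iff.2 ?_, tendsto_principal.2 hW⟩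
  refine (tendsto_atBot_add_const_right _ b.re tendsto_id).congr fun u => ?_
  simp

/-- A continuous nowhere zero function of `u` near `-∞` that is algebraic in `e ^ u` has a leading
term. -/
theorem exists_hasLeadingTerm {D : ℝ → ℂ} {R : ℝ} (hD : ContinuousOn D (Set.Iio R))
    (hD0 : ∀ u < R, D u ≠ 0) {P : Polynomial (Polynomial ℂ)} (hP : P ≠ 0)
    (hPD : ∀ u < R, P.evalEval (Complex.exp u) (D u) = 0) :
    ∃ (p : ℚ) (c : ℂ), HasLeadingTerm D p c := by
  -- The real half-line as a degenerate convex subset of ℂ, so that the complex theorem applies.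
  set W : Set ℂ := {w | w.im = 0} ∩ {w | w.re < R}
  have hW : Convex ℝ W :=
    (convex_hyperplane Complex.imLm.isLinear 0).inter (convex_halfSpace_re_lt R)
  have hline := tendsto_line_reAtBot (W := W) 0
    ((eventually_lt_atBot R).mono fun u hu => by simp [W, hu])
  have := hline.neBot
  obtain ⟨p, c, hc, h⟩ := exists_leading_term hW (D := fun w => D w.re)
    (hD.comp Complex.continuous_re.continuousOn fun w hw => hw.2) (fun w hw => hD0 _ hw.2) hP
    fun w hw => by
      have h1 : ((w.re : ℝ) : ℂ) = w := Complex.ext (by simp) (by simpa using hw.1.symm)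
      have h2 := hPD w.re hw.2
      rwa [h1] at h2
  exact ⟨p, c, hc, (h.comp hline).congr fun u => by simp⟩

/-- Translation back from the logarithmic coordinate: u = log σ(t) makes e^(pu) the real power
σ(t)^p. -/
theorem HasLeadingTerm.isEquivalent {D₀ D : ℝ → ℂ} {p : ℚ} {c : ℂ} (h : HasLeadingTerm D₀ p c)
    {l : Filter ℝ} {σ : ℝ → ℝ} (hσ : Tendsto σ l (𝓝[>] 0))
    (hD : ∀ᶠ t in l, D₀ (Real.log (σ t)) = D t) :
    Asymptotics.IsEquivalent l D fun t => c * ((σ t ^ (p : ℝ) : ℝ) : ℂ) := by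
  have h1 : Asymptotics.IsEquivalent l (fun t => D₀ (Real.log (σ t)) *
      Complex.exp (-(p * (Real.log (σ t) : ℝ)))) fun _ => c :=
    (Asymptotics.isEquivalent_const_iff_tendsto h.1).2
      (h.2.comp (Real.tendsto_log_nhdsGT_zero.comp hσ))
  refine (h1.mul (Asymptotics.IsEquivalent.refl
    (u := fun t => ((σ t ^ (p : ℝ) : ℝ) : ℂ)))).congr_left ?_
  filter_upwards [hD, hσ.eventually self_mem_nhdsWithin] with t ht hpos
  rw [Pi.mul_apply, Real.rpow_def_of_pos hpos, ht, mul_assoc, Complex.ofReal_exp,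
    ← Complex.exp_add]
  push_cast
  rw [mul_comm (p : ℂ), neg_add_cancel, Complex.exp_zero, mul_one]

/-! ### Solution paths and branches -/

/-- On either side of an isolated singularity inside the interval, the Jacobian determinant has a
leading term with positive exponent. -/
theorem exists_hasLeadingTerm_of_path {n m : ℕ} {f : PolySystem n m} {lam₀ lam₁ : Fin m → ℂ}
    {I : Set ℝ} {x : ℝ → Fin n → ℂ} {lam : ℝ → Fin m → ℂ}
    (hpath : IsSolutionPath f lam₀ lam₁ I x lam) {ts : ℝ}
    (hsing : HasIsolatedSingularityAt f I x lam ts) {σ : ℝ} (hσ : |σ| = 1) {r : ℝ} (hr : 0 < r)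
    (hI : ∀ s, 0 < s → s < r → ts + σ * s ∈ I) :
    ∃ (p : ℚ) (c : ℂ), 0 < p ∧ HasLeadingTerm (fun u => (jacobian f (x (ts + σ * Real.exp u))
      (lam (ts + σ * Real.exp u))).det) p c := by
  obtain ⟨ε, hε, hreg⟩ := Metric.mem_nhdsWithin_iff.1 hsing.isolated
  have hσ0 : σ ≠ 0 := by rintro rfl; simp at hσ
  have hcont : ContinuousOn (fun t => (jacobian f (x t) (lam t)).det) I :=
    continuousOn_det_jacobian f hpath.continuousOn_x hpath.continuousOn_lam
  -- For u < R the distance e^u keeps the point in the interval and in the punctured regular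
  -- neighbourhood.
  set R := Real.log (min r ε)
  have hexp : ∀ u < R, Real.exp u < r ∧ Real.exp u < ε := fun u hu =>
    lt_min_iff.1 ((Real.lt_log_iff_exp_lt (lt_min hr hε)).1 hu)
  have hmem : ∀ u < R, ts + σ * Real.exp u ∈ I := fun u hu =>
    hI _ (Real.exp_pos u) (hexp u hu).1
  have hregu : ∀ u < R, ¬ IsSingularPoint f (x (ts + σ * Real.exp u))
      (lam (ts + σ * Real.exp u)) := fun u hu => by
    refine hreg ⟨?_, hmem u hu, ?_⟩
    · rw [Metric.mem_ball, Real.dist_eq, add_sub_cancel_left, abs_mul, hσ, one_mul, Real.abs_exp]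
      exact (hexp u hu).2
    · simp [hσ0, Real.exp_ne_zero]
  obtain ⟨P, hP, hrel⟩ := exists_relation_det_jacobian f lam₀ lam₁ ts σ
  obtain ⟨p, c, h⟩ := exists_hasLeadingTerm (R := R)
    (D := fun u => (jacobian f (x (ts + σ * Real.exp u)) (lam (ts + σ * Real.exp u))).det)
    (hcont.comp (by fun_prop) hmem)
    (fun u hu => (det_jacobian_ne_zero_iff _ _ _).2 (hregu u hu)) hP
    fun u hu => hrel _ _ _ (by
      have := hpath.solves _ (hmem u hu)
      push_cast at this
      exact this) (hregu u hu)
  refine ⟨p, c, h.pos ?_, h⟩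
  have h0 : (jacobian f (x ts) (lam ts)).det = 0 := by
    by_contra h0
    exact (det_jacobian_ne_zero_iff f _ _).1 h0 hsing.singular
  have h1 := hcont ts hsing.mem
  rw [ContinuousWithinAt, h0] at h1
  refine h1.comp (tendsto_nhdsWithin_iff.2 ⟨?_, (eventually_lt_atBot R).mono hmem⟩)
  simpa using (Real.tendsto_exp_atBot.const_mul σ).const_add ts

/-- If both parts of the path belong to one branch, their leading terms are related by the turn. -/
theorem IsSameBranch.exists_hasLeadingTerm {n m : ℕ} {f : PolySystem n m} {lam₀ lam₁ : Fin m → ℂ}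
    {x : ℝ → Fin n → ℂ} {lam : ℝ → Fin m → ℂ} {ts : ℝ} {k : ℤ}
    (h : IsSameBranch f lam₀ lam₁ x lam ts k) :
    ∃ (p : ℚ) (c : ℂ),
      HasLeadingTerm (fun u => (jacobian f (x (ts + 1 * Real.exp u))
        (lam (ts + 1 * Real.exp u))).det) p c ∧
      HasLeadingTerm (fun u => (jacobian f (x (ts + -1 * Real.exp u))
        (lam (ts + -1 * Real.exp u))).det) p
        (c * Complex.exp ((2 * (k : ℂ) + 1) * (Real.pi : ℂ) * Complex.I * (p : ℂ))) := by
  obtain ⟨R, X, L, hX, hL, hsol, hright, hleft⟩ := h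
  obtain ⟨P, hP, hrel⟩ := exists_relation_det_jacobian f lam₀ lam₁ ts 1
  set b : ℂ := (2 * (k : ℂ) + 1) * (Real.pi : ℂ) * Complex.I with hb
  have hbre : b.re = 0 := by simp [hb]
  have hline : ∀ b : ℂ, b.re = 0 →
      Tendsto (fun u : ℝ => (u : ℂ) + b) atBot (reAtBot {w : ℂ | w.re < R}) := fun b hb =>
    tendsto_line_reAtBot b ((eventually_lt_atBot R).mono fun u hu => by simpa [hb] using hu)
  have := (hline 0 rfl).neBot
  -- One limit on the whole half plane, so both horizontal lines share `p` and `c`.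
  obtain ⟨p, c, hc, hlim⟩ := exists_leading_term (convex_halfSpace_re_lt R)
    (D := fun w => (jacobian f (X w) (L w)).det)
    (continuousOn_det_jacobian f hX hL)
    (fun w hw => (det_jacobian_ne_zero_iff _ _ _).2 (hsol w hw).2) hP
    fun w hw => hrel _ _ _ (by rw [one_mul]; exact (hsol w hw).1) (hsol w hw).2
  refine ⟨p, c, ⟨hc, ?_⟩, mul_ne_zero hc (Complex.exp_ne_zero _), ?_⟩
  · refine (hlim.comp (hline 0 rfl)).congr' ?_
    filter_upwards [eventually_lt_atBot R] with u hu
    rw [Function.comp_apply, add_zero, (hright u hu).1, (hright u hu).2, one_mul]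
  -- On this line e^(-p(u+b)) = e^(-pu) e^(-pb); multiplying by e^(bp) moves the constant factor
  -- into the limit.
  · refine ((hlim.comp (hline b hbre)).mul_const (Complex.exp (b * p))).congr' ?_
    filter_upwards [eventually_lt_atBot R] with u hu
    rw [Function.comp_apply, (hleft u hu).1, (hleft u hu).2, neg_one_mul, ← sub_eq_add_neg,
      mul_assoc, ← Complex.exp_add]
    congr 2
    ring

end Sweep

/-! ### Assembly and endpoints -/

open Filter Topology Sweep in
theorem lemma3 {n m : ℕ} (f : Sweep.PolySystem n m) (lam₀ lam₁ : Fin m → ℂ)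
    (t₁ t₃ : ℝ) (ht : t₁ < t₃)
    (x : ℝ → Fin n → ℂ) (lam : ℝ → Fin m → ℂ)
    (hpath : Sweep.IsSolutionPath f lam₀ lam₁ (Set.Icc t₁ t₃) x lam)
    (ts : ℝ) (hsing : Sweep.HasIsolatedSingularityAt f (Set.Icc t₁ t₃) x lam ts) :
    ∃ (p q : ℚ) (c d : ℂ), 0 < p ∧ 0 < q ∧ c ≠ 0 ∧ d ≠ 0 ∧
      Asymptotics.IsEquivalent (nhdsWithin ts (Set.Icc t₁ t₃ ∩ Set.Ioi ts))
        (fun t : ℝ => (Sweep.jacobian f (x t) (lam t)).det)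
        (fun t : ℝ => c * (((t - ts) ^ (p : ℝ) : ℝ) : ℂ)) ∧
      Asymptotics.IsEquivalent (nhdsWithin ts (Set.Icc t₁ t₃ ∩ Set.Iio ts))
        (fun t : ℝ => (Sweep.jacobian f (x t) (lam t)).det)
        (fun t : ℝ => d * (((ts - t) ^ (q : ℝ) : ℝ) : ℂ)) ∧
      ∀ k : ℤ, Sweep.IsSameBranch f lam₀ lam₁ x lam ts k →
        q = p ∧
        d = c * Complex.exp ((2 * (k : ℂ) + 1) * (Real.pi : ℂ) * Complex.I * (p : ℂ)) := by
  set D : ℝ → ℝ → ℂ := fun σ u => (jacobian f (x (ts + σ * Real.exp u))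
    (lam (ts + σ * Real.exp u))).det with hD
  have hts := hsing.mem
  have side : ∀ σ : ℝ, |σ| = 1 → ∀ r, 0 < r → (∀ s, 0 < s → s < r → ts + σ * s ∈ Set.Icc t₁ t₃) →
      ∃ (p : ℚ) (c : ℂ), 0 < p ∧ HasLeadingTerm (D σ) p c := fun σ hσ r hr hI =>
    exists_hasLeadingTerm_of_path hpath hsing hσ hr hI
  have right (h : ts < t₃) : ∃ (p : ℚ) (c : ℂ), 0 < p ∧ HasLeadingTerm (D 1) p c :=
    side 1 (by simp) (t₃ - ts) (by linarith) fun s h0 h1 => ⟨by linarith [hts.1], by linarith⟩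
  have left (h : t₁ < ts) : ∃ (p : ℚ) (c : ℂ), 0 < p ∧ HasLeadingTerm (D (-1)) p c :=
    side (-1) (by simp) (ts - t₁) (by linarith) fun s h0 h1 => ⟨by linarith, by linarith [hts.2]⟩
  have branch : ∀ k, IsSameBranch f lam₀ lam₁ x lam ts k → ∀ (p q : ℚ) (c d : ℂ),
      HasLeadingTerm (D 1) p c → HasLeadingTerm (D (-1)) q d → q = p ∧
        d = c * Complex.exp ((2 * (k : ℂ) + 1) * (Real.pi : ℂ) * Complex.I * (p : ℂ)) := by
    intro k hk p q c d hp hq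
    obtain ⟨p', c', h1, h2⟩ := hk.exists_hasLeadingTerm
    obtain ⟨rfl, rfl⟩ := hp.unique h1
    exact hq.unique h2
  have equivR : ∀ (p : ℚ) (c : ℂ), HasLeadingTerm (D 1) p c →
      Asymptotics.IsEquivalent (𝓝[Set.Icc t₁ t₃ ∩ Set.Ioi ts] ts)
        (fun t : ℝ => (jacobian f (x t) (lam t)).det)
        (fun t : ℝ => c * (((t - ts) ^ (p : ℝ) : ℝ) : ℂ)) := fun p c h => by
    have hpos : ∀ᶠ t in 𝓝[Set.Icc t₁ t₃ ∩ Set.Ioi ts] ts, 0 < t - ts :=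
      eventually_nhdsWithin_of_forall fun t ht => sub_pos.2 ht.2
    refine h.isEquivalent (tendsto_nhdsWithin_iff.2 ⟨?_, hpos⟩) ?_
    · have : Tendsto (fun t => t - ts) (𝓝 ts) (𝓝 (ts - ts)) := tendsto_id.sub_const ts
      rw [sub_self] at this
      exact this.mono_left nhdsWithin_le_nhds
    · filter_upwards [hpos] with t ht
      simp only [hD, Real.exp_log ht, one_mul, add_sub_cancel]
  have equivL : ∀ (q : ℚ) (d : ℂ), HasLeadingTerm (D (-1)) q d →
      Asymptotics.IsEquivalent (𝓝[Set.Icc t₁ t₃ ∩ Set.Iio ts] ts)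
        (fun t : ℝ => (jacobian f (x t) (lam t)).det)
        (fun t : ℝ => d * (((ts - t) ^ (q : ℝ) : ℝ) : ℂ)) := fun q d h => by
    have hpos : ∀ᶠ t in 𝓝[Set.Icc t₁ t₃ ∩ Set.Iio ts] ts, 0 < ts - t :=
      eventually_nhdsWithin_of_forall fun t ht => sub_pos.2 ht.2
    refine h.isEquivalent (tendsto_nhdsWithin_iff.2 ⟨?_, hpos⟩) ?_
    · have : Tendsto (fun t => ts - t) (𝓝 ts) (𝓝 (ts - ts)) := tendsto_id.const_sub ts
      rw [sub_self] at this
      exact this.mono_left nhdsWithin_le_nhds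
    · filter_upwards [hpos] with t ht
      simp only [hD, Real.exp_log ht, neg_one_mul, ← sub_eq_add_neg, sub_sub_cancel]
  rcases hts.2.lt_or_eq with h3 | h3
  · obtain ⟨p, c, hp0, hp⟩ := right h3
    rcases hts.1.lt_or_eq with h1 | h1
    · obtain ⟨q, d, hq0, hq⟩ := left h1
      exact ⟨p, q, c, d, hp0, hq0, hp.1, hq.1, equivR p c hp, equivL q d hq,
        fun k hk => branch k hk p q c d hp hq⟩
    -- At an endpoint one asymptotic clause is void, but `IsSameBranch` may still hold through
    -- values of the path functions outside the interval. The free pair `q`, `d` is therefore taken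
    -- from a branch if there is one; uniqueness of leading terms then covers every `k`.
    · by_cases hbr : ∃ k, IsSameBranch f lam₀ lam₁ x lam ts k
      · obtain ⟨k₀, hk₀⟩ := hbr
        obtain ⟨p', c', hr, hl⟩ := hk₀.exists_hasLeadingTerm
        obtain ⟨rfl, rfl⟩ := hp.unique hr
        exact ⟨p, p, c, _, hp0, hp0, hp.1, hl.1, equivR p c hp, equivL p _ hl,
          fun k hk => branch k hk p p c _ hp hl⟩
      · refine ⟨p, p, c, c, hp0, hp0, hp.1, hp.1, equivR p c hp, ?_,
          fun k hk => (hbr ⟨k, hk⟩).elim⟩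
        have hempty : Set.Icc t₁ t₃ ∩ Set.Iio ts = ∅ := by
          ext t; simp only [Set.mem_inter_iff, Set.mem_Icc, Set.mem_Iio, Set.mem_empty_iff_false]
          constructor
          · rintro ⟨⟨h, -⟩, h'⟩; linarith
          · exact False.elim
        rw [hempty, nhdsWithin_empty]
        exact Asymptotics.isLittleO_bot _ _
  · obtain ⟨q, d, hq0, hq⟩ := left (h3 ▸ ht)
    -- Mirror case: now the coefficient on the right is the free one and comes from the branch.
    by_cases hbr : ∃ k, IsSameBranch f lam₀ lam₁ x lam ts k
    · obtain ⟨k₀, hk₀⟩ := hbr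
      obtain ⟨p', c', hr, hl⟩ := hk₀.exists_hasLeadingTerm
      obtain ⟨rfl, -⟩ := hq.unique hl
      exact ⟨q, q, c', d, hq0, hq0, hr.1, hq.1, equivR q c' hr, equivL q d hq,
        fun k hk => branch k hk q q c' d hr hq⟩
    · refine ⟨q, q, d, d, hq0, hq0, hq.1, hq.1, ?_, equivL q d hq,
        fun k hk => (hbr ⟨k, hk⟩).elim⟩
      have hempty : Set.Icc t₁ t₃ ∩ Set.Ioi ts = ∅ := by
        ext t; simp only [Set.mem_inter_iff, Set.mem_Icc, Set.mem_Ioi, Set.mem_empty_iff_false]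
        constructor
        · rintro ⟨⟨-, h⟩, h'⟩; linarith
        · exact False.elim
      rw [hempty, nhdsWithin_empty]
      exact Asymptotics.isLittleO_bot _ _
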